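/- Let $\mathcal G=(Q,A,\sigma,\gamma)$ be a directed graph: $Q$ (vertices) and $A$ (arrows) are finite sets and $\sigma,\gamma:A\to Q$ are the source and goal maps. Let $W$ be the set of all admissible paths, that is, of all finite words $w=(a_1,\dots,a_n)$, $n\ge 0$, in $A$ with $\gamma(a_k)=\sigma(a_{k+1})$ for $1\le k\le n-1$. Assume that $\mathcal G$ is connected: for all $q,q'\in Q$ there is a path from $q$ to $q'$ (the empty path goes from each vertex to itself). For $w\in W$ let $\mathscr P(w)\in\mathbb R^A$ be the vector whose coordinate $\mathscr P(w)(a)$ is the number of occurrences of $a$ in $w$, and set $\nu=\sum_{w\in W}\delta_{\mathscr P(w)}$. Let $\psi_{\mathcal G}:\mathbb R^A\to\mathbb R\cup\{-\infty\}$ be the indicator of growth of $\nu$: $\psi_{\mathcal G}(0)=0$ and, for $x\ne 0$, $$\psi_{\mathcal G}(x)=\|x\|\,\inf\{\tau_{\mathcal C}\mid \mathcal C\subset\mathbb R^A\text{ an open cone with }x\in\mathcal C\},\qquad \tau_{\mathcal C}=\inf\Big\{s\in\mathbb R\ \Big|\ \int_{\mathcal C}e^{-s\|y\|}\,d\nu(y)<\infty\Big\},$$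 where $\|\cdot\|$ is a norm on $\mathbb R^A$ (the choice of which is irrelevant). Let $$\Omega_{\mathcal G}=\Big\{\theta\in\mathbb R^A\ \Big|\ \sum_{a\in A}\theta(a)x(a)\ge\psi_{\mathcal G}(x)\ \text{ for all }x\in\mathbb R^A\Big\}$$ be the closed convex set dual to $\psi_{\mathcal G}$. For $\theta\in\mathbb R^A$ let $L_\theta$ be the linear operator on $\mathbb R^Q$ given by $$(L_\theta f)(q)=\sum_{a\in A,\ \sigma(a)=q}e^{-\theta(a)}f(\gamma(a)),\qquad f\in\mathbb R^Q,\ q\in Q.$$ Then $\Omega_{\mathcal G}$ is exactly the set of $\theta\in\mathbb R^A$ for which $L_\theta$ has spectral radius (largest modulus of a complex eigenvalue) at most $1$. -/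

import Mathlib

open MeasureTheory
open scoped ENNReal TensorProduct

noncomputable section

/-! ### Indicator of growth of a measure -/

section Growth

variable {E : Type*} [NormedAddCommGroup E] [NormedSpace ℝ E] [MeasurableSpace E]

/-- The exponent of growth of `μ`: the infimum in `[-∞, ∞]` of the real numbers `s` with
`∫ exp (-s ‖x‖) dμ(x) < ∞` (it is `∞` if there is no such `s`). -/
def growthExponent (μ : Measure E) : EReal :=
  sInf ((fun s : ℝ => (s : EReal)) ''
    {s : ℝ | ∫⁻ x, ENNReal.ofReal (Real.exp (-s * ‖x‖)) ∂μ < ∞})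

/-- Open cones: open subsets that are stable under multiplication by positive real numbers. -/
def IsOpenCone (C : Set E) : Prop :=
  IsOpen C ∧ ∀ x ∈ C, ∀ t : ℝ, 0 < t → t • x ∈ C

open Classical in
/-- The indicator of growth `ψ_μ` of `μ`: `ψ_μ(0) = 0` and, for `x ≠ 0`, `ψ_μ(x)` is `‖x‖` times
the infimum, over the open cones `C` that contain `x`, of the exponent of growth of the restriction
of `μ` to `C`. On a finite-dimensional space it does not depend on the choice of the norm. -/
def growthIndicator (μ : Measure E) (x : E) : EReal :=
  if x = 0 then 0
  else (‖x‖ : EReal) * sInf ((fun C : Set E => growthExponent (μ.restrict C)) ''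
    {C : Set E | IsOpenCone C ∧ x ∈ C})

end Growth

/-- The subset `{φ | ∀ x, φ(x) ≥ ψ(x)}` of the dual space that is associated with a function
`ψ : E → [-∞, ∞]`. -/
def dualConvexSet {E : Type*} [AddCommGroup E] [Module ℝ E] (ψ : E → EReal) :
    Set (Module.Dual ℝ E) :=
  {φ | ∀ x : E, ψ x ≤ ((φ x : ℝ) : EReal)}

/-! ### Languages -/

/-- The vector of numbers of occurrences of the letters in a word. -/
def occurrenceVector {A : Type*} [DecidableEq A] (w : List A) : A → ℝ :=
  fun a => (w.count a : ℝ)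

/-- The measure `∑_{w ∈ W} δ_{P(w)}` on `ℝ^A`, where `P(w)` is the vector of numbers of occurrences
of the letters in `w`. -/
def Language.countingMeasure {A : Type*} [DecidableEq A] (W : Language A) : Measure (A → ℝ) :=
  Measure.sum fun w : {w : List A // w ∈ W} => Measure.dirac (occurrenceVector w.1)

/-- The indicator of growth `ψ_W` of the counting measure of the language `W`. -/
def Language.growthIndicator {A : Type*} [Fintype A] [DecidableEq A] (W : Language A) :
    (A → ℝ) → EReal :=
  _root_.growthIndicator W.countingMeasure

/-! ### Directed graphs -/

/-- A directed graph with vertices `Q` and arrows `A` (loops and multiple arrows are allowed). -/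
structure DirectedGraph (Q A : Type*) where
  /-- the source of an arrow -/
  source : A → Q
  /-- the goal of an arrow -/
  goal : A → Q

namespace DirectedGraph

variable {Q A : Type*}

/-- The language of all admissible paths (the empty one included): words `a₁ … aₙ` in which the goal
of each arrow is the source of the next one. -/
def pathLanguage (G : DirectedGraph Q A) : Language A :=
  {w : List A | w.IsChain fun a b => G.goal a = G.source b}

/-- The word `w` is a path from `q` to `q'`. The empty word is a path from each vertex to itself. -/
def IsPathFromTo (G : DirectedGraph Q A) (q q' : Q) (w : List A) : Prop :=
  w ∈ G.pathLanguage ∧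
    ((w = [] ∧ q = q') ∨ ∃ h : w ≠ [], G.source (w.head h) = q ∧ G.goal (w.getLast h) = q')

/-- The graph is connected: there is a path from each vertex to each vertex. -/
def Connected (G : DirectedGraph Q A) : Prop :=
  ∀ q q' : Q, ∃ w : List A, G.IsPathFromTo q q' w

/-- The function `ψ_G` on `ℝ^A`: the indicator of growth of the language of paths. -/
def psi [Fintype A] [DecidableEq A] (G : DirectedGraph Q A) : (A → ℝ) → EReal :=
  G.pathLanguage.growthIndicator

/-- The set `Ω_G` dual to `ψ_G`, seen in `ℝ^A` through the identification of `ℝ^A` with its dual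
space by the standard inner product. -/
def Omega [Fintype A] [DecidableEq A] (G : DirectedGraph Q A) : Set (A → ℝ) :=
  {θ | dotProductEquiv ℝ A θ ∈ dualConvexSet G.psi}

/-- The transfer operator `(L_θ f)(q) = ∑_{σ(a) = q} exp (-θ(a)) f(γ(a))` on `ℝ^Q`. -/
def transferOperator [Fintype A] [DecidableEq Q] (G : DirectedGraph Q A) (θ : A → ℝ) :
    Module.End ℝ (Q → ℝ) where
  toFun f q := ∑ a with G.source a = q, Real.exp (-θ a) * f (G.goal a)
  map_add' f g := by
    funext q
    simp [mul_add, Finset.sum_add_distrib]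
  map_smul' c f := by
    funext q
    simp [Finset.mul_sum, mul_left_comm]

end DirectedGraph

/-- The spectral radius of an endomorphism of a finite-dimensional real vector space: the largest
modulus of a complex eigenvalue, that is, of an element of the spectrum of the complexification. -/
def realSpectralRadius {V : Type*} [AddCommGroup V] [Module ℝ V] (T : Module.End ℝ V) : ℝ≥0∞ :=
  spectralRadius ℂ (A := Module.End ℂ (ℂ ⊗[ℝ] V)) (LinearMap.baseChange ℂ T)

end

open Filter Topology

/-! ### Growth indicators and convergence of Laplace integrals -/

section GrowthLemmas

variable {E : Type*} [NormedAddCommGroup E] [MeasurableSpace E]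

/-! Both conditions on θ amount to the convergence, for all ε > 0 and every vertex q, of the series
∑ₙ e^{-εn} (L_θⁿ 1)(q). By `sum_pathsFrom_exp`, (L_θⁿ 1)(q) is the sum of e^{-θ·P(w)} over the paths
w of length n from q. Up to the multiplicity of the empty path, these series thus regroup the
integral of e^{-(θ·y + ε|y|)} against ν, where |y| is the sum of the coordinates.

On the side of Ω_G, integrability of e^{-φ} forces φ ≥ ψ, and φ ≥ ψ gives back integrability after
adding ε‖·‖, by compactness of the unit sphere. On the spectral side, L_θ is positive, so the
sup-norm operator norm of L_θⁿ is the maximum of L_θⁿ 1, and Gelfand's formula turns radius ≤ 1 into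
subexponential growth (`realSpectralRadius_le_one_iff`). -/

theorem growthExponent_le {μ : Measure E} {s : ℝ}
    (h : ∫⁻ x, ENNReal.ofReal (Real.exp (-s * ‖x‖)) ∂μ < ∞) : growthExponent μ ≤ s :=
  sInf_le ⟨s, h, rfl⟩

theorem lintegral_lt_top_of_growthExponent_lt {μ : Measure E} {s : ℝ}
    (h : growthExponent μ < s) : ∫⁻ x, ENNReal.ofReal (Real.exp (-s * ‖x‖)) ∂μ < ∞ := by
  obtain ⟨_, ⟨t, ht, rfl⟩, hts : (t : EReal) < s⟩ := sInf_lt_iff.1 h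
  refine lt_of_le_of_lt (lintegral_mono fun x => ENNReal.ofReal_le_ofReal (Real.exp_le_exp.2 ?_)) ht
  have : t < s := by exact_mod_cast hts
  nlinarith [norm_nonneg x]

variable [NormedSpace ℝ E]

/-- If `exp (-φ)` is integrable, then `φ` dominates the indicator of growth. -/
theorem growthIndicator_le_of_lintegral_lt_top [OpensMeasurableSpace E] {μ : Measure E}
    (φ : E →L[ℝ] ℝ) (h : ∫⁻ x, ENNReal.ofReal (Real.exp (-φ x)) ∂μ < ∞) (x : E) :
    growthIndicator μ x ≤ (φ x : ℝ) := by
  unfold growthIndicator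
  split_ifs with hx
  · simp [hx]
  have hx0 : 0 < ‖x‖ := norm_pos_iff.2 hx
  have key : ∀ δ : ℝ, 0 < δ → sInf ((fun C : Set E => growthExponent (μ.restrict C)) ''
      {C : Set E | IsOpenCone C ∧ x ∈ C}) ≤ ((φ x / ‖x‖ + δ : ℝ) : EReal) := by
    intro δ hδ
    -- The cone {φ < s‖·‖} contains x because δ > 0, and on it e^{-s‖y‖} ≤ e^{-φ(y)}.
    set s := φ x / ‖x‖ + δ with hs
    have hopen : IsOpen {y : E | φ y < s * ‖y‖} := isOpen_lt (by fun_prop) (by fun_prop)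
    have hcone : IsOpenCone {y : E | φ y < s * ‖y‖} := by
      refine ⟨hopen, fun y hy t ht => ?_⟩
      simp only [Set.mem_ofPred_eq, map_smul, smul_eq_mul, norm_smul, Real.norm_eq_abs,
        abs_of_pos ht] at hy ⊢
      nlinarith
    have hmem : x ∈ {y : E | φ y < s * ‖y‖} := by
      have : φ x / ‖x‖ * ‖x‖ = φ x := div_mul_cancel₀ _ hx0.ne'
      simp only [Set.mem_ofPred_eq, hs]
      nlinarith
    refine le_trans (sInf_le (Set.mem_image_of_mem _ (Set.mem_ofPred_eq.mpr ⟨hcone, hmem⟩)))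
      (growthExponent_le ?_)
    refine lt_of_le_of_lt ?_ h
    refine le_trans (setLIntegral_mono_ae' hopen.measurableSet (ae_of_all _ fun y hy => ?_))
      (setLIntegral_le_lintegral _ _)
    refine ENNReal.ofReal_le_ofReal (Real.exp_le_exp.2 ?_)
    have : φ y < s * ‖y‖ := hy
    linarith
  have hlim : Tendsto (fun δ : ℝ => ((φ x / ‖x‖ + δ : ℝ) : EReal)) (𝓝[>] 0)
      (𝓝 ((φ x / ‖x‖ : ℝ) : EReal)) := by
    refine (continuous_coe_real_ereal.tendsto _).comp (tendsto_nhdsWithin_of_tendsto_nhds ?_)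
    exact Continuous.tendsto' (by fun_prop) _ _ (add_zero _)
  have hle := ge_of_tendsto hlim (eventually_nhdsWithin_of_forall key)
  calc (‖x‖ : EReal) * _ ≤ (‖x‖ : EReal) * ((φ x / ‖x‖ : ℝ) : EReal) :=
        mul_le_mul_of_nonneg_left hle (by exact_mod_cast hx0.le)
    _ = (φ x : ℝ) := by
        rw [← EReal.coe_mul, mul_div_cancel₀ _ hx0.ne']

/-- If `φ` dominates the indicator of growth and `ε > 0`, then `exp (-(φ + ε ‖·‖))` is
integrable. -/
theorem lintegral_lt_top_of_growthIndicator_le [ProperSpace E] [OpensMeasurableSpace E]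
    {μ : Measure E} (h0 : μ {0} < ∞) (φ : E →L[ℝ] ℝ)
    (h : ∀ x, growthIndicator μ x ≤ (φ x : ℝ)) {ε : ℝ} (hε : 0 < ε) :
    ∫⁻ x, ENNReal.ofReal (Real.exp (-(φ x + ε * ‖x‖))) ∂μ < ∞ := by
  have key : ∀ x ∈ Metric.sphere (0 : E) 1, ∃ C : Set E, IsOpenCone C ∧ x ∈ C ∧
      ∫⁻ y in C, ENNReal.ofReal (Real.exp (-(φ y + ε * ‖y‖))) ∂μ < ∞ := by
    intro x hx
    have hx1 : ‖x‖ = 1 := by simpa using hx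
    have hxne : x ≠ 0 := fun h => by simp [h] at hx1
    have h1 := h x
    rw [growthIndicator, if_neg hxne, hx1, EReal.coe_one, one_mul] at h1
    -- Half of ε gives the strict inequality that yields a cone; the other half keeps s‖·‖ < φ +
    -- ε‖·‖ near the direction x.
    have h2 := h1.trans_lt (show ((φ x : ℝ) : EReal) < ((φ x + ε / 2 : ℝ) : EReal) by
      exact_mod_cast (by linarith : φ x < φ x + ε / 2))
    obtain ⟨_, ⟨C, ⟨hC, hxC⟩, rfl⟩, hlt⟩ := sInf_lt_iff.1 h2
    have hint := lintegral_lt_top_of_growthExponent_lt hlt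
    set s := φ x + ε / 2 with hs
    have hopen : IsOpen {y : E | s * ‖y‖ < φ y + ε * ‖y‖} :=
      isOpen_lt (by fun_prop) (by fun_prop)
    refine ⟨C ∩ {y | s * ‖y‖ < φ y + ε * ‖y‖}, ⟨hC.1.inter hopen, ?_⟩, ⟨hxC, ?_⟩, ?_⟩
    · rintro y ⟨hyC, hy⟩ t ht
      refine ⟨hC.2 y hyC t ht, ?_⟩
      simp only [Set.mem_ofPred_eq, map_smul, smul_eq_mul, norm_smul, Real.norm_eq_abs,
        abs_of_pos ht] at hy ⊢
      nlinarith
    · simp only [Set.mem_ofPred_eq, hx1, hs]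
      linarith
    · refine lt_of_le_of_lt (le_trans (setLIntegral_mono_ae'
        (hC.1.inter hopen).measurableSet (ae_of_all _ fun y hy => ?_))
        (lintegral_mono_set Set.inter_subset_left)) hint
      refine ENNReal.ofReal_le_ofReal (Real.exp_le_exp.2 ?_)
      have : s * ‖y‖ < φ y + ε * ‖y‖ := hy.2
      linarith
  choose! C hC hxC hfin using key
  -- Finitely many cones cover the sphere, hence everything but the origin, where `h0` takes over.
  obtain ⟨t, ht, hcov⟩ := (isCompact_sphere (0 : E) 1).elim_nhds_subcover C
    fun x hx => (hC x hx).1.mem_nhds (hxC x hx)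
  have huniv : (Set.univ : Set E) ⊆ {0} ∪ ⋃ x ∈ t, C x := by
    intro y _
    by_cases hy : y = 0
    · exact Or.inl hy
    right
    have hy0 : 0 < ‖y‖ := norm_pos_iff.2 hy
    have hmem : ‖y‖⁻¹ • y ∈ Metric.sphere (0 : E) 1 := by
      simp [norm_smul, hy0.ne']
    obtain ⟨x, hxt, hyx⟩ := Set.mem_iUnion₂.1 (hcov hmem)
    have := (hC x (ht x hxt)).2 _ hyx ‖y‖ hy0
    rw [smul_inv_smul₀ hy0.ne'] at this
    exact Set.mem_iUnion₂.2 ⟨x, hxt, this⟩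
  rw [← setLIntegral_univ]
  refine (lintegral_mono_set huniv).trans_lt ((lintegral_union_le _ _ _).trans_lt
    (ENNReal.add_lt_top.2 ⟨?_, ?_⟩))
  · rw [setLIntegral_congr_fun (g := fun _ => 1) (measurableSet_singleton _)
      (by rintro _ rfl; simp)]
    simpa using h0
  · simp_rw [← Finset.mem_coe]
    rw [Set.biUnion_eq_iUnion]
    refine (lintegral_iUnion_le _ _).trans_lt ?_
    rw [tsum_fintype]
    exact ENNReal.sum_lt_top.2 fun x _ => hfin x.1 (ht x.1 x.2)

end GrowthLemmas

/-! ### Spectral radius and subexponential growth -/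

section SpectralRadius

open scoped Matrix.Norms.Operator

/-- Gelfand's formula, with the n-th root removed. -/
theorem spectralRadius_le_one_iff {B : Type*} [NormedRing B] [NormedAlgebra ℂ B] [CompleteSpace B]
    (a : B) :
    spectralRadius ℂ a ≤ 1 ↔ ∀ ε : ℝ, 0 < ε → ∀ᶠ n : ℕ in atTop, ‖a ^ n‖ ≤ Real.exp (ε * n) := by
  have hlim := spectrum.pow_norm_pow_one_div_tendsto_nhds_spectralRadius a
  have hpow : ∀ ε : ℝ, ∀ n : ℕ, 0 < n →
      (‖a ^ n‖ ^ (1 / n : ℝ) ≤ Real.exp ε ↔ ‖a ^ n‖ ≤ Real.exp (ε * n)) := by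
    intro ε n hn
    have hn' : (0 : ℝ) < n := by exact_mod_cast hn
    rw [Real.exp_mul, one_div, Real.rpow_inv_le_iff_of_pos (norm_nonneg _) (Real.exp_pos _).le hn']
  constructor
  · intro h ε hε
    have h1 : spectralRadius ℂ a < ENNReal.ofReal (Real.exp ε) := by
      refine h.trans_lt ?_
      rw [← ENNReal.ofReal_one]
      exact (ENNReal.ofReal_lt_ofReal_iff (Real.exp_pos _)).2 (Real.one_lt_exp_iff.2 hε)
    filter_upwards [hlim.eventually (gt_mem_nhds h1), eventually_gt_atTop 0] with n hn hn0
    exact (hpow ε n hn0).1 ((ENNReal.ofReal_lt_ofReal_iff (Real.exp_pos _)).1 hn).le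
  · intro h
    have h1 : ∀ ε : ℝ, 0 < ε → spectralRadius ℂ a ≤ ENNReal.ofReal (Real.exp ε) := by
      intro ε hε
      refine le_of_tendsto hlim ?_
      filter_upwards [h ε hε, eventually_gt_atTop 0] with n hn hn0
      exact ENNReal.ofReal_le_ofReal ((hpow ε n hn0).2 hn)
    have h2 : Tendsto (fun ε : ℝ => ENNReal.ofReal (Real.exp ε)) (𝓝[>] 0) (𝓝 1) := by
      refine tendsto_nhdsWithin_of_tendsto_nhds ?_
      exact (ENNReal.continuous_ofReal.comp Real.continuous_exp).tendsto' _ _ (by simp)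
    exact ge_of_tendsto h2 (eventually_nhdsWithin_of_forall h1)

theorem realSpectralRadius_eq_spectralRadius_matrix {Q : Type*} [Fintype Q] [DecidableEq Q]
    (T : Module.End ℝ (Q → ℝ)) :
    realSpectralRadius T =
      spectralRadius ℂ ((LinearMap.toMatrix' T).map (algebraMap ℝ ℂ)) := by
  let b := Algebra.TensorProduct.basis ℂ (Pi.basisFun ℝ Q)
  have h : LinearMap.toMatrixAlgEquiv b (LinearMap.baseChange ℂ T) =
      (LinearMap.toMatrix' T).map (algebraMap ℝ ℂ) := by
    rw [← LinearMap.toMatrix_eq_toMatrix']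
    exact LinearMap.toMatrix_baseChange ℂ T (Pi.basisFun ℝ Q) (Pi.basisFun ℝ Q)
  rw [← h, realSpectralRadius, spectralRadius, spectralRadius,
    AlgEquiv.spectrum_eq (LinearMap.toMatrixAlgEquiv b) (LinearMap.baseChange ℂ T)]

/-- An operator that preserves nonnegativity has spectral radius at most `1` if and only if its
iterates on the constant function `1` grow subexponentially. -/
theorem realSpectralRadius_le_one_iff {Q : Type*} [Fintype Q] [DecidableEq Q]
    (T : Module.End ℝ (Q → ℝ)) (hT : ∀ f : Q → ℝ, 0 ≤ f → 0 ≤ T f) :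
    realSpectralRadius T ≤ 1 ↔
      ∀ ε : ℝ, 0 < ε → ∀ᶠ n : ℕ in atTop, ∀ q, (T ^ n) 1 q ≤ Real.exp (ε * n) := by
  have hTn : ∀ (n : ℕ) (f : Q → ℝ), 0 ≤ f → 0 ≤ (T ^ n) f := by
    intro n
    induction n with
    | zero => intro f hf; simpa using hf
    | succ n ih => intro f hf; rw [pow_succ]; exact ih _ (hT f hf)
  -- Positivity makes the entries of the matrix of Tⁿ equal to their moduli, and the operator norm
  -- for the sup norm is the largest row sum of moduli.
  have hrow : ∀ (n : ℕ) (q : Q),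
      ∑ j, ‖(((LinearMap.toMatrix' T).map (algebraMap ℝ ℂ)) ^ n) q j‖ = (T ^ n) 1 q := by
    intro n q
    rw [← Matrix.map_pow, show LinearMap.toMatrix' T ^ n = LinearMap.toMatrix' (T ^ n) from
      (map_pow LinearMap.toMatrixAlgEquiv' T n).symm]
    have h1 : (T ^ n) 1 q = ∑ j, LinearMap.toMatrix' (T ^ n) q j := by
      rw [← LinearMap.toMatrix'_mulVec (T ^ n) 1]
      simp only [Matrix.mulVec, dotProduct, Pi.one_apply, mul_one]
    rw [h1]
    refine Finset.sum_congr rfl fun j _ => ?_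
    have h2 : 0 ≤ LinearMap.toMatrix' (T ^ n) q j := by
      rw [LinearMap.toMatrix'_apply]
      refine hTn n _ (fun i => ?_) q
      by_cases hij : i = j <;> simp [hij]
    rw [Matrix.map_apply, norm_algebraMap', Real.norm_of_nonneg h2]
  have hnorm : ∀ (n : ℕ) (c : ℝ), 0 ≤ c →
      (‖((LinearMap.toMatrix' T).map (algebraMap ℝ ℂ)) ^ n‖ ≤ c ↔ ∀ q, (T ^ n) 1 q ≤ c) := by
    intro n c hc
    lift c to NNReal using hc
    rw [← coe_nnnorm, NNReal.coe_le_coe, Matrix.linfty_opNNNorm_def, Finset.sup_le_iff]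
    simp_rw [← hrow, ← NNReal.coe_le_coe]
    simp
  rw [realSpectralRadius_eq_spectralRadius_matrix, spectralRadius_le_one_iff]
  simp_rw [hnorm _ _ (Real.exp_pos _).le]

end SpectralRadius

/-! ### Counting measure and occurrence vectors -/

theorem Language.lintegral_countingMeasure {A : Type*} [Finite A] [DecidableEq A] (W : Language A)
    (f : (A → ℝ) → ℝ≥0∞) :
    ∫⁻ y, f y ∂W.countingMeasure = ∑' w : {w : List A // w ∈ W}, f (occurrenceVector w.1) := by
  simp [Language.countingMeasure, lintegral_sum_measure]

section OccurrenceVector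

variable {A : Type*} [Fintype A] [DecidableEq A]

theorem dotProduct_occurrenceVector_cons (θ : A → ℝ) (a : A) (w : List A) :
    θ ⬝ᵥ occurrenceVector (a :: w) = θ a + θ ⬝ᵥ occurrenceVector w := by
  simp [dotProduct, occurrenceVector, List.count_cons, mul_add, Finset.sum_add_distrib, add_comm]

theorem sum_occurrenceVector (w : List A) : ∑ a, occurrenceVector w a = w.length := by
  induction w with
  | nil => simp [occurrenceVector]
  | cons a w ih =>
    have h := dotProduct_occurrenceVector_cons 1 a w
    rw [one_dotProduct, one_dotProduct, ih] at h
    rw [h, List.length_cons, Pi.one_apply]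
    push_cast
    ring

theorem norm_occurrenceVector_le (w : List A) : ‖occurrenceVector w‖ ≤ w.length := by
  refine (pi_norm_le_iff_of_nonneg (Nat.cast_nonneg _)).2 fun a => ?_
  simpa [occurrenceVector] using List.count_le_length

/-- The coordinates of P(w) add up to the length of w, so only the empty word contributes to the
mass at 0. -/
theorem Language.countingMeasure_singleton_zero_lt_top (W : Language A) :
    W.countingMeasure {0} < ∞ := by
  rw [← lintegral_indicator_one (measurableSet_singleton _), W.lintegral_countingMeasure]
  have hne : ∀ w : List A, w ≠ [] → occurrenceVector w ≠ 0 := by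
    intro w hw h
    have h1 := sum_occurrenceVector w
    rw [h] at h1
    simp only [Pi.zero_apply, Finset.sum_const_zero] at h1
    exact hw (List.length_eq_zero_iff.1 (by exact_mod_cast h1.symm))
  refine lt_of_le_of_lt (ENNReal.tsum_comp_le_tsum_of_injective Subtype.val_injective
    (fun w : List A => Set.indicator {0} (1 : (A → ℝ) → ℝ≥0∞) (occurrenceVector w))) ?_
  rw [tsum_eq_single []]
  · refine lt_of_le_of_lt (Set.indicator_le_self _ _ _) ENNReal.one_lt_top
  · exact fun w hw => Set.indicator_of_notMem (mt Set.mem_singleton_iff.1 (hne w hw)) _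

end OccurrenceVector

/-! ### Weighted path counts and the two inclusions -/

namespace DirectedGraph

variable {Q A : Type*} [Fintype A]

theorem transferOperator_nonneg [DecidableEq Q] (G : DirectedGraph Q A) (θ : A → ℝ) (f : Q → ℝ) (hf : 0 ≤ f) :
    0 ≤ G.transferOperator θ f :=
  fun _ => Finset.sum_nonneg fun a _ => mul_nonneg (Real.exp_pos _).le (hf (G.goal a))

variable [DecidableEq A]

theorem mem_Omega_iff (G : DirectedGraph Q A) (θ : A → ℝ) :
    θ ∈ G.Omega ↔
      ∀ x, _root_.growthIndicator G.pathLanguage.countingMeasure x ≤ ((θ ⬝ᵥ x : ℝ) : EReal) :=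
  Iff.rfl

variable [DecidableEq Q]

/-- The paths of length `n` that start at `q`. -/
def pathsFrom (G : DirectedGraph Q A) : ℕ → Q → Finset (List A)
  | 0, _ => {[]}
  | n + 1, q => (Finset.univ.filter fun a => G.source a = q).biUnion fun a =>
      (pathsFrom G n (G.goal a)).map ⟨List.cons a, List.cons_injective⟩

theorem mem_pathsFrom (G : DirectedGraph Q A) {n : ℕ} {q : Q} {w : List A} :
    w ∈ G.pathsFrom n q ↔
      -- The condition on `head?` is vacuous for the empty word, which starts at every vertex.
      w.length = n ∧ w ∈ G.pathLanguage ∧ ∀ a ∈ w.head?, G.source a = q := by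
  have hmem : ∀ v : List A, v ∈ G.pathLanguage ↔ v.IsChain fun a b => G.goal a = G.source b :=
    fun _ => Iff.rfl
  induction n generalizing q w with
  | zero =>
    cases w <;> simp [pathsFrom, hmem]
  | succ n ih =>
    cases w with
    | nil => simp [pathsFrom]
    | cons a w =>
      simp only [pathsFrom, Finset.mem_biUnion, Finset.mem_filter, Finset.mem_univ, true_and,
        Finset.mem_map, Function.Embedding.coeFn_mk, List.cons.injEq, ih, hmem,
        List.isChain_cons, List.length_cons, List.head?_cons, Option.mem_def, Option.some.injEq]
      constructor
      · rintro ⟨_, hq, _, ⟨hl, hw, hh⟩, rfl, rfl⟩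
        exact ⟨by rw [hl], ⟨fun b hb => (hh b hb).symm, hw⟩, by rintro _ rfl; exact hq⟩
      · rintro ⟨hl, ⟨hh, hw⟩, hq⟩
        exact ⟨a, hq a rfl, w, ⟨by omega, hw, fun b hb => (hh b hb).symm⟩, rfl, rfl⟩

/-- The iterates of the transfer operator on the constant function `1` count weighted paths. -/
theorem sum_pathsFrom_exp (G : DirectedGraph Q A) (θ : A → ℝ) (n : ℕ) (q : Q) :
    ∑ w ∈ G.pathsFrom n q, Real.exp (-(θ ⬝ᵥ occurrenceVector w)) =
      (G.transferOperator θ ^ n) 1 q := by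
  induction n generalizing q with
  | zero =>
    simp [pathsFrom, occurrenceVector, dotProduct]
  | succ n ih =>
    have hstep : (G.transferOperator θ ^ (n + 1)) 1 q = ∑ a with G.source a = q,
        Real.exp (-θ a) * (G.transferOperator θ ^ n) 1 (G.goal a) := by
      rw [pow_succ']
      rfl
    rw [hstep, pathsFrom, Finset.sum_biUnion]
    · refine Finset.sum_congr rfl fun a _ => ?_
      rw [← ih, Finset.mul_sum, Finset.sum_map]
      refine Finset.sum_congr rfl fun w _ => ?_
      rw [← Real.exp_add, Function.Embedding.coeFn_mk, dotProduct_occurrenceVector_cons]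
      congr 1
      ring
    -- Paths with distinct first arrows are distinct, so the union over first arrows is disjoint.
    · intro a _ b _ hab
      rw [Function.onFun, Finset.disjoint_left]
      intro w hw hw'
      simp only [Finset.mem_map, Function.Embedding.coeFn_mk] at hw hw'
      obtain ⟨_, _, rfl⟩ := hw
      obtain ⟨_, _, h⟩ := hw'
      exact hab (List.cons.inj h).1.symm

theorem sum_pathsFrom_ofReal_exp (G : DirectedGraph Q A) (θ : A → ℝ) (ε : ℝ) (n : ℕ) (q : Q) :
    ∑ w ∈ G.pathsFrom n q,
        ENNReal.ofReal (Real.exp (-(θ ⬝ᵥ occurrenceVector w + ε * w.length))) =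
      ENNReal.ofReal (Real.exp (-(ε * n)) * (G.transferOperator θ ^ n) 1 q) := by
  rw [← sum_pathsFrom_exp, Finset.mul_sum,
    ENNReal.ofReal_sum_of_nonneg fun _ _ => by positivity]
  refine Finset.sum_congr rfl fun w hw => ?_
  rw [(G.mem_pathsFrom.1 hw).1, ← Real.exp_add]
  congr 2
  ring

/-- Only an inequality: the right side counts the empty path once for each vertex. -/
theorem tsum_pathLanguage_le [Fintype Q] [Nonempty Q] (G : DirectedGraph Q A)
    (f : List A → ℝ≥0∞) :
    ∑' w : {w : List A // w ∈ G.pathLanguage}, f w.1 ≤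
      ∑' n, ∑ q, ∑ w ∈ G.pathsFrom n q, f w := by
  have hstart : ∀ w : List A, ∃ q, ∀ a ∈ w.head?, G.source a = q := by
    rintro (_ | ⟨a, w⟩)
    · exact ⟨Classical.arbitrary Q, by simp⟩
    · exact ⟨G.source a, by simp⟩
  choose s hs using hstart
  let i : {w : List A // w ∈ G.pathLanguage} → Σ n : ℕ, Σ q : Q, {w // w ∈ G.pathsFrom n q} :=
    fun w => ⟨w.1.length, s w.1, w.1, G.mem_pathsFrom.2 ⟨rfl, w.2, hs w.1⟩⟩
  have hi : Function.Injective i :=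
    Function.LeftInverse.injective
      (g := fun p => ⟨p.2.2.1, (G.mem_pathsFrom.1 p.2.2.2).2.1⟩) fun _ => rfl
  refine (ENNReal.tsum_comp_le_tsum_of_injective hi fun p => f p.2.2.1).trans_eq ?_
  rw [ENNReal.tsum_sigma']
  refine tsum_congr fun n => ?_
  rw [ENNReal.tsum_sigma', tsum_fintype]
  exact Finset.sum_congr rfl fun q _ => Finset.tsum_subtype _ _

theorem tsum_sum_pathsFrom_le (G : DirectedGraph Q A) (q : Q) (f : List A → ℝ≥0∞) :
    ∑' n, ∑ w ∈ G.pathsFrom n q, f w ≤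
      ∑' w : {w : List A // w ∈ G.pathLanguage}, f w.1 := by
  let i : (Σ n : ℕ, {w // w ∈ G.pathsFrom n q}) → {w : List A // w ∈ G.pathLanguage} :=
    fun p => ⟨p.2.1, (G.mem_pathsFrom.1 p.2.2).2.1⟩
  have hi : Function.Injective i := by
    rintro ⟨n, w, hw⟩ ⟨m, v, hv⟩ h
    obtain rfl : w = v := congrArg Subtype.val h
    obtain rfl : n = m := (G.mem_pathsFrom.1 hw).1.symm.trans (G.mem_pathsFrom.1 hv).1
    rfl
  refine Eq.trans_le ?_ (ENNReal.tsum_comp_le_tsum_of_injective hi fun w => f w.1)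
  rw [ENNReal.tsum_sigma']
  exact tsum_congr fun n => (Finset.tsum_subtype _ _).symm

/-- The terms e^{-εn} (L_θⁿ 1)(q) of a convergent series are eventually below 1, which is the
required growth bound. -/
theorem realSpectralRadius_le_one_of_mem_Omega [Fintype Q] (G : DirectedGraph Q A) {θ : A → ℝ}
    (hθ : θ ∈ G.Omega) : realSpectralRadius (G.transferOperator θ) ≤ 1 := by
  rw [realSpectralRadius_le_one_iff _ (G.transferOperator_nonneg θ)]
  intro ε hε
  have hint := lintegral_lt_top_of_growthIndicator_le
    G.pathLanguage.countingMeasure_singleton_zero_lt_top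
    (dotProductEquiv ℝ A θ).toContinuousLinearMap ((G.mem_Omega_iff θ).1 hθ) hε
  rw [Language.lintegral_countingMeasure] at hint
  rw [eventually_all]
  intro q
  have hsum : ∑' n : ℕ, ENNReal.ofReal (Real.exp (-(ε * n)) * (G.transferOperator θ ^ n) 1 q)
      ≠ ∞ := by
    simp_rw [← G.sum_pathsFrom_ofReal_exp θ ε]
    refine ((G.tsum_sum_pathsFrom_le q _).trans_lt
      (lt_of_le_of_lt (ENNReal.tsum_le_tsum fun w => ?_) hint)).ne
    refine ENNReal.ofReal_le_ofReal (Real.exp_le_exp.2 (neg_le_neg ?_))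
    -- The sup norm of P(w) is at most the length of w, so weighting by length only makes the terms
    -- smaller.
    exact add_le_add_right
      (mul_le_mul_of_nonneg_left (norm_occurrenceVector_le w.1) hε.le) _
  filter_upwards [(ENNReal.tendsto_atTop_zero_of_tsum_ne_top hsum).eventually
    (gt_mem_nhds one_pos)] with n hn
  have h1 := (ENNReal.ofReal_lt_one.1 hn).le
  rwa [Real.exp_neg, inv_mul_le_iff₀ (Real.exp_pos _), mul_one] at h1

theorem mem_Omega_of_realSpectralRadius_le_one [Fintype Q] (G : DirectedGraph Q A) {θ : A → ℝ}
    (hθ : realSpectralRadius (G.transferOperator θ) ≤ 1) : θ ∈ G.Omega := by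
  rw [realSpectralRadius_le_one_iff _ (G.transferOperator_nonneg θ)] at hθ
  rw [mem_Omega_iff]
  intro x
  by_cases hx : x = 0
  · simp [hx, _root_.growthIndicator]
  -- A nonzero x needs an arrow, hence a vertex.
  obtain ⟨a, -⟩ := Function.ne_iff.1 hx
  have : Nonempty Q := ⟨G.source a⟩
  -- Adding ε to every coordinate of θ adds ε times the length while keeping the form linear; ε
  -- tends to 0 at the end.
  have key : ∀ ε : ℝ, 0 < ε → _root_.growthIndicator G.pathLanguage.countingMeasure x ≤
      (((θ + ε • 1) ⬝ᵥ x : ℝ) : EReal) := by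
    intro ε hε
    refine growthIndicator_le_of_lintegral_lt_top
      (dotProductEquiv ℝ A (θ + ε • 1)).toContinuousLinearMap ?_ x
    rw [Language.lintegral_countingMeasure]
    have hdot : ∀ w : List A, (θ + ε • 1) ⬝ᵥ occurrenceVector w =
        θ ⬝ᵥ occurrenceVector w + ε * w.length := by
      intro w
      rw [add_dotProduct, smul_dotProduct, one_dotProduct, sum_occurrenceVector, smul_eq_mul]
    refine lt_of_eq_of_lt (tsum_congr fun w =>
      congrArg (fun r : ℝ => ENNReal.ofReal (Real.exp (-r))) (hdot w.1)) ?_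
    refine (G.tsum_pathLanguage_le fun w =>
      ENNReal.ofReal (Real.exp (-(θ ⬝ᵥ occurrenceVector w + ε * w.length)))).trans_lt ?_
    simp_rw [G.sum_pathsFrom_ofReal_exp θ ε]
    rw [Summable.tsum_finsetSum fun _ _ => ENNReal.summable, ENNReal.sum_lt_top]
    intro q _
    refine Summable.tsum_ofReal_lt_top ?_
    refine summable_of_isBigO_nat (Real.summable_exp_nat_mul_iff.2 (by linarith : -(ε / 2) < 0))
      (Asymptotics.IsBigO.of_bound 1 ?_)
    -- Growth at rate ε/2 against the weight e^{-εn} leaves a geometric series of ratio e^{-ε/2}.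
    filter_upwards [hθ (ε / 2) (half_pos hε)] with n hn
    have h0 : 0 ≤ (G.transferOperator θ ^ n) 1 q := by
      rw [← sum_pathsFrom_exp]
      exact Finset.sum_nonneg fun _ _ => (Real.exp_pos _).le
    rw [one_mul, Real.norm_of_nonneg (by positivity), Real.norm_of_nonneg (Real.exp_pos _).le]
    calc Real.exp (-(ε * n)) * (G.transferOperator θ ^ n) 1 q
        ≤ Real.exp (-(ε * n)) * Real.exp (ε / 2 * n) := by gcongr; exact hn q
      _ = Real.exp (n * -(ε / 2)) := by
          rw [← Real.exp_add]
          congr 1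
          ring
  have hlim : Tendsto (fun ε : ℝ => (((θ + ε • 1) ⬝ᵥ x : ℝ) : EReal)) (𝓝[>] 0)
      (𝓝 ((θ ⬝ᵥ x : ℝ) : EReal)) := by
    refine (continuous_coe_real_ereal.tendsto _).comp (tendsto_nhdsWithin_of_tendsto_nhds ?_)
    simp_rw [add_dotProduct, smul_dotProduct]
    exact Continuous.tendsto' (by fun_prop) _ _ (by simp)
  exact ge_of_tendsto hlim (eventually_nhdsWithin_of_forall key)

end DirectedGraph

theorem mainTheorem6 {Q A : Type*} [Fintype Q] [DecidableEq Q] [Fintype A] [DecidableEq A]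
    (G : DirectedGraph Q A) (hG : G.Connected) :
    G.Omega = {θ : A → ℝ | realSpectralRadius (G.transferOperator θ) ≤ 1} :=
  Set.ext fun _ => ⟨G.realSpectralRadius_le_one_of_mem_Omega,
    G.mem_Omega_of_realSpectralRadius_le_one⟩
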